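/- Let $\mathbb{K}$ be a field and let $q\in\mathbb{K}\setminus\{0\}$ be not a root of unity. Let $\mathcal{A}$ be the quantum spatial ageing algebra, i.e. the unital associative $\mathbb{K}$-algebra generated by $E, K, K^{-1}, X, Y$ subject to the relations $KK^{-1}=K^{-1}K=1$ and $$EK=q^{-2}KE,\quad XK=q^{-1}KX,\quad YK=qKY,\quad EX=qXE,\quad EY=X+q^{-1}YE,\quad qYX=XY.$$ For an ideal $\mathfrak{p}$ of the Laurent polynomial algebra $\mathbb{K}[K^{\pm1}]$ let $(Y,E,\mathfrak{p})$ be the two-sided ideal of $\mathcal{A}$ generated by $Y$, $E$ and (the image of) $\mathfrak{p}$, and let $\mathcal{P}=\{(Y,E,\mathfrak{p}) : \mathfrak{p}\in\mathrm{Max}(\mathbb{K}[K^{\pm1}])\}$, where $\mathrm{Max}$ denotes the set of maximal ideals. Modules are left modules. 1. For every $\mathfrak{p}\in\mathrm{Max}(\mathbb{K}[K^{\pm1}])$, the $\mathcal{A}$-module $\mathcal{A}/(Y,E,\mathfrak{p})$ is simple, finite-dimensional over $\mathbb{K}$ and has annihilator $(Y,E,\mathfrak{p})$. There is an isomorphism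 of $\mathbb{K}$-algebras $\mathcal{A}/(Y,E,\mathfrak{p})\simeq\mathbb{K}[K^{\pm1}]/\mathfrak{p}$ that sends the class of $K$ to the class of $K$ and the classes of $E$, $X$, $Y$ to $0$ (so, as a module, $\mathcal{A}/(Y,E,\mathfrak{p})$ is $\mathbb{K}[K^{\pm1}]/\mathfrak{p}$ with $K$ acting by multiplication and $E,X,Y$ acting by zero). 2. If $\mathfrak{p},\mathfrak{p}'\in\mathrm{Max}(\mathbb{K}[K^{\pm1}])$ and the $\mathcal{A}$-modules $\mathcal{A}/(Y,E,\mathfrak{p})$ and $\mathcal{A}/(Y,E,\mathfrak{p}')$ are isomorphic, then $\mathfrak{p}=\mathfrak{p}'$. 3. A simple $\mathcal{A}$-module $M$ is finite-dimensional over $\mathbb{K}$ if and only if $M\simeq\mathcal{A}/(Y,E,\mathfrak{p})$ for some $\mathfrak{p}\in\mathrm{Max}(\mathbb{K}[K^{\pm1}])$, and also if and only if its annihilator belongs to $\mathcal{P}$. In other words, writing $\widehat{\mathcal{A}}(\text{fin. dim.})$ for the set of isomorphism classes of simple finite-dimensional $\mathcal{A}$-modules and $\widehat{\mathcal{A}}(P)$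 for the set of isomorphism classes of simple $\mathcal{A}$-modules with annihilator $P$, $$\widehat{\mathcal{A}}(\text{fin. dim.})=\Big\{[\mathcal{A}/(Y,E,\mathfrak{p})\simeq\mathbb{K}[K^{\pm1}]/\mathfrak{p}] : \mathfrak{p}\in\mathrm{Max}(\mathbb{K}[K^{\pm1}])\Big\}=\bigsqcup_{P\in\mathcal{P}}\widehat{\mathcal{A}}(P).$$ -/

import Mathlib

namespace QuantumAgeing

/-- The five canonical generators `E, K, K⁻¹, X, Y`. -/
inductive Gen : Type
  | E | K | Kinv | X | Y

/-- The generator of the free algebra attached to an element of `Gen`. -/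
abbrev gen {𝕜 : Type*} [Field 𝕜] (g : Gen) : FreeAlgebra 𝕜 Gen := FreeAlgebra.ι 𝕜 g

/-- The defining relations of the quantum spatial ageing algebra (the first two say that `Kinv` is
the inverse of `K`). -/
inductive Rel {𝕜 : Type*} [Field 𝕜] (q : 𝕜) : FreeAlgebra 𝕜 Gen → FreeAlgebra 𝕜 Gen → Prop
  | K_Kinv : Rel q (gen .K * gen .Kinv) 1
  | Kinv_K : Rel q (gen .Kinv * gen .K) 1
  | E_K : Rel q (gen .E * gen .K) ((q ^ 2)⁻¹ • (gen .K * gen .E))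
  | X_K : Rel q (gen .X * gen .K) (q⁻¹ • (gen .K * gen .X))
  | Y_K : Rel q (gen .Y * gen .K) (q • (gen .K * gen .Y))
  | E_X : Rel q (gen .E * gen .X) (q • (gen .X * gen .E))
  | E_Y : Rel q (gen .E * gen .Y) (gen .X + q⁻¹ • (gen .Y * gen .E))
  | Y_X : Rel q (q • (gen .Y * gen .X)) (gen .X * gen .Y)

/-- The quantum spatial ageing algebra `𝓐` over the field `𝕜` with parameter `q`: the unital
associative `𝕜`-algebra presented by the generators `Gen` and the relations `Rel q`. -/
def Alg {𝕜 : Type*} [Field 𝕜] (q : 𝕜) : Type _ := RingQuot (Rel q)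

noncomputable instance {𝕜 : Type*} [Field 𝕜] (q : 𝕜) : Ring (Alg q) :=
  inferInstanceAs (Ring (RingQuot (Rel q)))

noncomputable instance {𝕜 : Type*} [Field 𝕜] (q : 𝕜) : Algebra 𝕜 (Alg q) :=
  inferInstanceAs (Algebra 𝕜 (RingQuot (Rel q)))

/-- The canonical surjection from the free algebra onto `𝓐`. -/
noncomputable def Alg.mk {𝕜 : Type*} [Field 𝕜] (q : 𝕜) : FreeAlgebra 𝕜 Gen →ₐ[𝕜] Alg q :=
  RingQuot.mkAlgHom 𝕜 (Rel q)

/-- The image of a canonical generator in `𝓐`. -/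
noncomputable def Alg.of {𝕜 : Type*} [Field 𝕜] (q : 𝕜) (g : Gen) : Alg q :=
  Alg.mk q (gen g)

/-- `K` as a unit of `𝓐`. -/
noncomputable def Alg.unitK {𝕜 : Type*} [Field 𝕜] (q : 𝕜) : (Alg q)ˣ where
  val := Alg.of q .K
  inv := Alg.of q .Kinv
  val_inv := by
    have h : Alg.mk q _ = Alg.mk q _ := RingQuot.mkAlgHom_rel 𝕜 (Rel.K_Kinv (q := q))
    rw [map_mul, map_one] at h
    exact h
  inv_val := by
    have h : Alg.mk q _ = Alg.mk q _ := RingQuot.mkAlgHom_rel 𝕜 (Rel.Kinv_K (q := q))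
    rw [map_mul, map_one] at h
    exact h

/-- The homomorphism of `𝕜`-algebras `𝕜[K, K⁻¹] → 𝓐` that sends the Laurent variable `T` to `K`. -/
noncomputable def Alg.ofLaurent {𝕜 : Type*} [Field 𝕜] (q : 𝕜) :
    LaurentPolynomial 𝕜 →ₐ[𝕜] Alg q :=
  AddMonoidAlgebra.lift 𝕜 (Alg q) ℤ
    ((Units.coeHom (Alg q)).comp (zpowersHom (Alg q)ˣ (Alg.unitK q)))

/-- The two-sided ideal `(Y, E, 𝔭)` of `𝓐`, generated by `Y`, `E` and the image of `𝔭`. It is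
recorded as a left ideal, so that `𝓐 ⧸ (Y, E, 𝔭)` is a left `𝓐`-module; as the ideal is two-sided,
the quotient is a `𝕜`-algebra as well. -/
noncomputable def idealYE {𝕜 : Type*} [Field 𝕜] (q : 𝕜) (p : Ideal (LaurentPolynomial 𝕜)) :
    Ideal (Alg q) :=
  (TwoSidedIdeal.span
    ({Alg.of q .Y, Alg.of q .E} ∪ Alg.ofLaurent q '' (p : Set (LaurentPolynomial 𝕜)))).asIdeal

instance {𝕜 : Type*} [Field 𝕜] (q : 𝕜) (p : Ideal (LaurentPolynomial 𝕜)) :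
    (idealYE q p).IsTwoSided :=
  inferInstanceAs (TwoSidedIdeal.asIdeal _).IsTwoSided

/-- The family `𝓟` of all ideals `(Y, E, 𝔭)` with `𝔭` a maximal ideal of `𝕜[K, K⁻¹]`. -/
def familyP {𝕜 : Type*} [Field 𝕜] (q : 𝕜) : Set (Ideal (Alg q)) :=
  {P | ∃ p : Ideal (LaurentPolynomial 𝕜), p.IsMaximal ∧ P = idealYE q p}

end QuantumAgeing

open QuantumAgeing

namespace QuantumAgeing

/-! ### Relations between the generators of `𝓐`. -/

section Generators

variable {𝕜 : Type*} [Field 𝕜] (q : 𝕜)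

/-! Since `X = EY - q⁻¹YE`, killing `E` and `Y` also kills `X` and leaves `𝕜[K, K⁻¹]`. Hence `(Y, E,
𝔭)` is the preimage of `𝔭` under a split surjection (`idealYE_eq_comap`), so it is maximal even as a
left ideal and determines `𝔭`; its quotient is a field, finite over `𝕜` by Zariski's lemma.

Conversely, on a finite-dimensional simple module each of `X`, `E`, `Y` commutes with the invertible
`K` up to a scalar that is not a root of unity, so comparing determinants makes it singular. Taken
in the order `X`, `E`, `Y`, each kernel is a nonzero submodule, hence everything
(`E_Y_mem_annihilator`). The module is then a simple module over `𝕜[K, K⁻¹]`. -/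

theorem Alg.mk_eq_of_rel {a b : FreeAlgebra 𝕜 Gen} (h : Rel q a b) : Alg.mk q a = Alg.mk q b :=
  RingQuot.mkAlgHom_rel 𝕜 h

theorem Alg.mk_surjective : Function.Surjective (Alg.mk q) :=
  RingQuot.mkAlgHom_surjective 𝕜 (Rel q)

theorem Alg.K_mul_Kinv : Alg.of q .K * Alg.of q .Kinv = 1 := (Alg.unitK q).val_inv

theorem Alg.Kinv_mul_K : Alg.of q .Kinv * Alg.of q .K = 1 := (Alg.unitK q).inv_val

theorem Alg.E_mul_K : Alg.of q .E * Alg.of q .K = (q ^ 2)⁻¹ • (Alg.of q .K * Alg.of q .E) := by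
  simpa only [map_mul, map_smul, map_add, Alg.of] using Alg.mk_eq_of_rel q Rel.E_K

theorem Alg.X_mul_K : Alg.of q .X * Alg.of q .K = q⁻¹ • (Alg.of q .K * Alg.of q .X) := by
  simpa only [map_mul, map_smul, map_add, Alg.of] using Alg.mk_eq_of_rel q Rel.X_K

theorem Alg.Y_mul_K : Alg.of q .Y * Alg.of q .K = q • (Alg.of q .K * Alg.of q .Y) := by
  simpa only [map_mul, map_smul, map_add, Alg.of] using Alg.mk_eq_of_rel q Rel.Y_K

theorem Alg.E_mul_X : Alg.of q .E * Alg.of q .X = q • (Alg.of q .X * Alg.of q .E) := by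
  simpa only [map_mul, map_smul, map_add, Alg.of] using Alg.mk_eq_of_rel q Rel.E_X

theorem Alg.E_mul_Y :
    Alg.of q .E * Alg.of q .Y = Alg.of q .X + q⁻¹ • (Alg.of q .Y * Alg.of q .E) := by
  simpa only [map_mul, map_smul, map_add, Alg.of] using Alg.mk_eq_of_rel q Rel.E_Y

theorem Alg.X_mul_Y : Alg.of q .X * Alg.of q .Y = q • (Alg.of q .Y * Alg.of q .X) := by
  simpa only [map_mul, map_smul, Alg.of] using (Alg.mk_eq_of_rel q Rel.Y_X).symm

theorem Alg.algHom_ext {B : Type*} [Ring B] [Algebra 𝕜 B] {f g : Alg q →ₐ[𝕜] B}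
    (h : ∀ x, f (Alg.of q x) = g (Alg.of q x)) : f = g := by
  have h' : f.comp (Alg.mk q) = g.comp (Alg.mk q) := FreeAlgebra.hom_ext (funext h)
  ext a
  obtain ⟨a, rfl⟩ := Alg.mk_surjective q a
  exact DFunLike.congr_fun h' a

/-- A set of vectors closed under the linear operations and the generators is closed under `𝓐`. -/
theorem Alg.smul_mem_of_forall_gen {M : Type*} [AddCommGroup M] [Module (Alg q) M] (N : AddSubgroup M)
    (hc : ∀ (c : 𝕜), ∀ v ∈ N, algebraMap 𝕜 (Alg q) c • v ∈ N)
    (hg : ∀ x, ∀ v ∈ N, Alg.of q x • v ∈ N) (a : Alg q) : ∀ v ∈ N, a • v ∈ N := by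
  obtain ⟨a, rfl⟩ := Alg.mk_surjective q a
  induction a using FreeAlgebra.induction with
  | grade0 c => simpa using hc c
  | grade1 x => exact hg x
  | mul a b ha hb =>
    intro v hv
    rw [map_mul, mul_smul]
    exact ha _ (hb _ hv)
  | add a b ha hb =>
    intro v hv
    rw [map_add, add_smul]
    exact N.add_mem (ha _ hv) (hb _ hv)

theorem Alg.ofLaurent_T (n : ℤ) :
    Alg.ofLaurent q (LaurentPolynomial.T n) = (Alg.unitK q ^ n : (Alg q)ˣ) := by
  refine (AddMonoidAlgebra.lift_single ..).trans ?_
  rw [one_smul]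
  rfl

theorem Alg.ofLaurent_T_one : Alg.ofLaurent q (LaurentPolynomial.T 1) = Alg.of q .K := by
  rw [Alg.ofLaurent_T, zpow_one]
  rfl

theorem Alg.ofLaurent_T_neg_one : Alg.ofLaurent q (LaurentPolynomial.T (-1)) = Alg.of q .Kinv := by
  rw [Alg.ofLaurent_T, zpow_neg_one]
  rfl

end Generators

/-! ### The retraction of `𝓐` onto `𝕜[K, K⁻¹]`. -/

section Projection

variable {𝕜 : Type*} [Field 𝕜] (q : 𝕜)

theorem T_one_mul_T_neg_one {R : Type*} [Semiring R] :
    LaurentPolynomial.T 1 * LaurentPolynomial.T (-1) = (1 : LaurentPolynomial R) := by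
  rw [← LaurentPolynomial.T_add, add_neg_cancel, LaurentPolynomial.T_zero]

theorem T_neg_one_mul_T_one {R : Type*} [Semiring R] :
    LaurentPolynomial.T (-1) * LaurentPolynomial.T 1 = (1 : LaurentPolynomial R) := by
  rw [← LaurentPolynomial.T_add, neg_add_cancel, LaurentPolynomial.T_zero]

/-- The images of the generators under the projection of `𝓐` onto `𝕜[K, K⁻¹]`. -/
noncomputable def toLaurentGen (𝕜 : Type*) [Field 𝕜] : Gen → LaurentPolynomial 𝕜
  | .K => LaurentPolynomial.T 1
  | .Kinv => LaurentPolynomial.T (-1)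
  | _ => 0

/-- The projection of `𝓐` onto `𝕜[K, K⁻¹]` that kills `E`, `X` and `Y`. -/
noncomputable def Alg.toLaurent : Alg q →ₐ[𝕜] LaurentPolynomial 𝕜 :=
  RingQuot.liftAlgHom 𝕜 ⟨FreeAlgebra.lift 𝕜 (toLaurentGen 𝕜), by
    intro a b h
    cases h <;>
      simp only [gen, map_mul, map_smul, map_add, map_one, FreeAlgebra.lift_ι_apply, toLaurentGen,
        T_one_mul_T_neg_one, T_neg_one_mul_T_one, mul_zero, zero_mul, smul_zero, add_zero]⟩

theorem Alg.toLaurent_of (x : Gen) : Alg.toLaurent q (Alg.of q x) = toLaurentGen 𝕜 x := by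
  have h : Alg.toLaurent q (Alg.mk q (gen x)) = _ := RingQuot.liftAlgHom_mkAlgHom_apply ..
  exact h.trans (by simp)

theorem Alg.toLaurent_ofLaurent (f : LaurentPolynomial 𝕜) :
    Alg.toLaurent q (Alg.ofLaurent q f) = f := by
  have h : (Alg.toLaurent q).comp (Alg.ofLaurent q) = AlgHom.id 𝕜 (LaurentPolynomial 𝕜) := by
    refine AddMonoidAlgebra.algHom_ext' ?_ (Subsingleton.elim _ _)
    -- A homomorphism out of the infinite cyclic group is fixed by its value on the generator, so
    -- only `K` has to be checked.
    apply MonoidHom.ext_mint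
    have h := Alg.ofLaurent_T_one q
    have h' := Alg.toLaurent_of q .K
    rw [← h] at h'
    exact h'
  exact DFunLike.congr_fun h f

theorem Alg.toLaurent_surjective : Function.Surjective (Alg.toLaurent q) :=
  fun f => ⟨_, Alg.toLaurent_ofLaurent q f⟩

variable (p : Ideal (LaurentPolynomial 𝕜))

theorem mem_idealYE_of_mem {a : Alg q}
    (h : a ∈ ({Alg.of q .Y, Alg.of q .E} ∪ Alg.ofLaurent q '' (p : Set (LaurentPolynomial 𝕜)))) :
    a ∈ idealYE q p :=
  TwoSidedIdeal.mem_asIdeal.2 (TwoSidedIdeal.subset_span h)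

theorem Y_mem_idealYE : Alg.of q .Y ∈ idealYE q p := mem_idealYE_of_mem q p (by simp)

theorem E_mem_idealYE : Alg.of q .E ∈ idealYE q p := mem_idealYE_of_mem q p (by simp)

theorem X_mem_of_E_mem_of_Y_mem {I : Ideal (Alg q)} [I.IsTwoSided] (hE : Alg.of q .E ∈ I)
    (hY : Alg.of q .Y ∈ I) : Alg.of q .X ∈ I := by
  have h := Alg.E_mul_Y q
  rw [← sub_eq_iff_eq_add] at h
  rw [← h, ← smul_mul_assoc]
  exact I.sub_mem (I.mul_mem_left _ hY) (I.mul_mem_left _ hE)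

/-- Modulo a two-sided ideal containing `E` and `Y`, every element is a Laurent polynomial
in `K`. -/
theorem sub_ofLaurent_toLaurent_mem {I : Ideal (Alg q)} [I.IsTwoSided] (hE : Alg.of q .E ∈ I)
    (hY : Alg.of q .Y ∈ I) (a : Alg q) : a - Alg.ofLaurent q (Alg.toLaurent q a) ∈ I := by
  have hX := X_mem_of_E_mem_of_Y_mem q hE hY
  have h : Ideal.Quotient.mkₐ 𝕜 I =
      (Ideal.Quotient.mkₐ 𝕜 I).comp ((Alg.ofLaurent q).comp (Alg.toLaurent q)) := by
    refine Alg.algHom_ext q fun x => ?_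
    simp only [AlgHom.comp_apply, Alg.toLaurent_of]
    cases x
    · simpa [toLaurentGen] using Ideal.Quotient.eq_zero_iff_mem.2 hE
    · simp [toLaurentGen, Alg.ofLaurent_T_one]
    · simp [toLaurentGen, Alg.ofLaurent_T_neg_one]
    · simpa [toLaurentGen] using Ideal.Quotient.eq_zero_iff_mem.2 hX
    · simpa [toLaurentGen] using Ideal.Quotient.eq_zero_iff_mem.2 hY
  exact Ideal.Quotient.eq.1 (DFunLike.congr_fun h a)

/-- The projection sends the generators of `(Y, E, 𝔭)` into `𝔭`; conversely, an element differs from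
the Laurent polynomial it projects to by an element of `(Y, E, 𝔭)`. -/
theorem idealYE_eq_comap : idealYE q p = p.comap (Alg.toLaurent q) := by
  apply le_antisymm
  · intro a ha
    have hle : TwoSidedIdeal.span ({Alg.of q .Y, Alg.of q .E} ∪
        Alg.ofLaurent q '' (p : Set (LaurentPolynomial 𝕜))) ≤
        (p.comap (Alg.toLaurent q)).toTwoSided := by
      rw [TwoSidedIdeal.span_le]
      rintro a ((rfl | rfl) | ⟨f, hf, rfl⟩)
      · simp [Alg.toLaurent_of, toLaurentGen]
      · simp [Alg.toLaurent_of, toLaurentGen]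
      · simpa [Alg.toLaurent_ofLaurent] using hf
    simpa using hle (TwoSidedIdeal.mem_asIdeal.1 ha)
  · intro a ha
    have h := sub_ofLaurent_toLaurent_mem q (E_mem_idealYE q p) (Y_mem_idealYE q p) a
    have h' : Alg.ofLaurent q (Alg.toLaurent q a) ∈ idealYE q p :=
      mem_idealYE_of_mem q p (Or.inr ⟨_, ha, rfl⟩)
    simpa using (idealYE q p).add_mem h h'

theorem idealYE_injective : Function.Injective (idealYE q) := by
  intro p p' h
  rw [idealYE_eq_comap, idealYE_eq_comap] at h
  exact Ideal.comap_injective_of_surjective _ (Alg.toLaurent_surjective q) h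

theorem idealYE_isMaximal [p.IsMaximal] : (idealYE q p).IsMaximal := by
  rw [idealYE_eq_comap]
  exact Ideal.comap_isMaximal_of_surjective _ (Alg.toLaurent_surjective q)

theorem isMaximal_of_idealYE_isMaximal (h : (idealYE q p).IsMaximal) : p.IsMaximal := by
  rw [idealYE_eq_comap] at h
  have hmap := Ideal.map_comap_of_surjective _ (Alg.toLaurent_surjective q) p
  rcases Ideal.map_eq_top_or_isMaximal_of_surjective _ (Alg.toLaurent_surjective q) h with h' | h'
  · rw [hmap] at h'
    exact absurd (by rw [h', Ideal.comap_top]) h.ne_top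
  · rwa [hmap] at h'

/-- The isomorphism `𝓐 ⧸ (Y, E, 𝔭) ≃ 𝕜[K, K⁻¹] ⧸ 𝔭`. -/
noncomputable def quotientIdealYEEquiv : (Alg q ⧸ idealYE q p) ≃ₐ[𝕜] (LaurentPolynomial 𝕜 ⧸ p) :=
  (Ideal.quotientEquivAlgOfEq 𝕜 (by
    rw [idealYE_eq_comap]
    ext a
    simp [RingHom.mem_ker, Ideal.Quotient.eq_zero_iff_mem])).trans
  (Ideal.quotientKerAlgEquivOfSurjective (f := (Ideal.Quotient.mkₐ 𝕜 p).comp (Alg.toLaurent q))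
    ((Ideal.Quotient.mkₐ_surjective 𝕜 p).comp (Alg.toLaurent_surjective q)))

theorem quotientIdealYEEquiv_mk (a : Alg q) :
    quotientIdealYEEquiv q p (Ideal.Quotient.mk _ a) = Ideal.Quotient.mk p (Alg.toLaurent q a) :=
  rfl

theorem finiteDimensional_quotient_idealYE [p.IsMaximal] :
    FiniteDimensional 𝕜 (Alg q ⧸ idealYE q p) := by
  -- Zariski's lemma: a field that is finitely generated as a `𝕜`-algebra is finite over `𝕜`.
  let := Ideal.Quotient.field p
  have : Algebra.FiniteType 𝕜 (LaurentPolynomial 𝕜) :=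
    inferInstanceAs (Algebra.FiniteType 𝕜 (AddMonoidAlgebra 𝕜 ℤ))
  have : Module.Finite 𝕜 (LaurentPolynomial 𝕜 ⧸ p) :=
    finite_of_finite_type_of_isJacobsonRing 𝕜 (LaurentPolynomial 𝕜 ⧸ p)
  exact Module.Finite.equiv (quotientIdealYEEquiv q p).symm.toLinearEquiv

end Projection

/-! ### Vanishing of `E`, `X`, `Y` on finite-dimensional simple modules. -/

section FiniteDimensional

/-- An endomorphism that commutes up to a scalar that is not a root of unity with an automorphism
of a nonzero finite-dimensional space has a nonzero kernel. -/
theorem ker_ne_bot_of_comp_eq_smul {𝕜 M : Type*} [Field 𝕜] [AddCommGroup M] [Module 𝕜 M]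
    [FiniteDimensional 𝕜 M] [Nontrivial M] {f k k' : Module.End 𝕜 M} {c : 𝕜}
    (hc : ∀ n : ℕ, 0 < n → c ^ n ≠ 1) (hk : k * k' = 1) (h : f * k = c • (k * f)) :
    LinearMap.ker f ≠ ⊥ := by
  intro hf
  have hf' : LinearMap.det f ≠ 0 := fun h0 => (LinearMap.bot_lt_ker_of_det_eq_zero h0).ne' hf
  have hk' : LinearMap.det k ≠ 0 := by
    intro h0
    have := congrArg LinearMap.det hk
    simp [h0] at this
  have hd := congrArg LinearMap.det h
  -- Both sides become `det k * det f`, the right one with the extra factor `c ^ finrank`; the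
  -- exponent is positive because `M` is nontrivial.
  rw [LinearMap.det_smul, map_mul, map_mul, mul_comm (LinearMap.det f)] at hd
  exact hc _ Module.finrank_pos
    (mul_right_cancel₀ (mul_ne_zero hk' hf') (by rw [← hd, one_mul]))

variable {𝕜 : Type*} [Field 𝕜] (q : 𝕜) {M : Type*} [AddCommGroup M] [Module 𝕜 M]
  [Module (Alg q) M] [IsScalarTower 𝕜 (Alg q) M]

/-- On a simple finite-dimensional module, an element that commutes with `K` up to a scalar that is
not a root of unity acts as zero as soon as its kernel is stable under `E`, `X` and `Y`. -/
theorem mem_annihilator_of_mul_K [FiniteDimensional 𝕜 M] [IsSimpleModule (Alg q) M] {a : Alg q}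
    {c : 𝕜} (hc0 : c ≠ 0) (hc : ∀ n : ℕ, 0 < n → c ^ n ≠ 1)
    (haK : a * Alg.of q .K = c • (Alg.of q .K * a))
    (hE : ∀ v : M, a • v = 0 → a • Alg.of q .E • v = 0)
    (hX : ∀ v : M, a • v = 0 → a • Alg.of q .X • v = 0)
    (hY : ∀ v : M, a • v = 0 → a • Alg.of q .Y • v = 0) :
    a ∈ Module.annihilator (Alg q) M := by
  have := IsSimpleModule.nontrivial (Alg q) M
  have haKinv : a * Alg.of q .Kinv = c⁻¹ • (Alg.of q .Kinv * a) := by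
    calc a * Alg.of q .Kinv
        = Alg.of q .Kinv * (c⁻¹ • (c • (Alg.of q .K * a))) * Alg.of q .Kinv := by
          rw [inv_smul_smul₀ hc0, ← mul_assoc, Alg.Kinv_mul_K, one_mul]
      _ = c⁻¹ • (Alg.of q .Kinv * a) := by
          rw [← haK, mul_smul_comm, smul_mul_assoc, mul_assoc, mul_assoc a, Alg.K_mul_Kinv, mul_one]
  let N : AddSubgroup M := (DistribSMul.toAddMonoidHom M a).ker
  have hN : ∀ v, v ∈ N ↔ a • v = 0 := fun v => Iff.rfl
  have hker := ker_ne_bot_of_comp_eq_smul (f := Algebra.lsmul 𝕜 𝕜 M a)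
    (k := Algebra.lsmul 𝕜 𝕜 M (Alg.of q .K)) (k' := Algebra.lsmul 𝕜 𝕜 M (Alg.of q .Kinv)) hc
    (by rw [← map_mul, Alg.K_mul_Kinv, map_one]) (by rw [← map_mul, haK, map_smul, map_mul])
  -- Stability under `K` and `K⁻¹` comes from the commutation with `a`, so the kernel of `a` is a
  -- submodule; simplicity leaves only `⊤`.
  let S : Submodule (Alg q) M :=
    { N with
      smul_mem' := fun b v hv => Alg.smul_mem_of_forall_gen q N
        (fun c v hv => by
          rw [hN] at hv ⊢
          rw [← mul_smul, ← Algebra.commutes, mul_smul, hv, smul_zero])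
        (fun x v hv => by
          rw [hN] at hv ⊢
          cases x
          · exact hE v hv
          · rw [← mul_smul, haK, smul_assoc, mul_smul, hv, smul_zero, smul_zero]
          · rw [← mul_smul, haKinv, smul_assoc, mul_smul, hv, smul_zero, smul_zero]
          · exact hX v hv
          · exact hY v hv) b v hv }
  have hS : S = ⊤ := by
    refine (eq_bot_or_eq_top S).resolve_left fun h => hker ?_
    refine (Submodule.eq_bot_iff _).2 fun v hv => ?_
    exact (Submodule.eq_bot_iff S).1 h v hv
  exact Module.mem_annihilator.2 fun v => (hS ▸ Submodule.mem_top : v ∈ S)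

variable (M) in
-- The order matters: `X` commutes with `E` and `Y` up to scalars, so its kernel is stable at once;
-- for `E`, stability under `Y` needs `X = 0` in `EY = X + q⁻¹YE`; for `Y`, both `E = 0` and `X = 0`
-- are used.
theorem E_Y_mem_annihilator [FiniteDimensional 𝕜 M] [IsSimpleModule (Alg q) M] (hq0 : q ≠ 0)
    (hq : ∀ n : ℕ, 0 < n → q ^ n ≠ 1) :
    Alg.of q .E ∈ Module.annihilator (Alg q) M ∧ Alg.of q .Y ∈ Module.annihilator (Alg q) M := by
  have hqi : ∀ n : ℕ, 0 < n → q⁻¹ ^ n ≠ 1 := fun n hn => by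
    rw [inv_pow, ne_eq, inv_eq_one]
    exact hq n hn
  have hq2 : ∀ n : ℕ, 0 < n → ((q ^ 2)⁻¹) ^ n ≠ 1 := fun n hn => by
    rw [inv_pow, ne_eq, inv_eq_one, ← pow_mul]
    exact hq _ (by positivity)
  have hX : ∀ v : M, Alg.of q .X • v = 0 := by
    refine Module.mem_annihilator.1 (mem_annihilator_of_mul_K q (inv_ne_zero hq0) hqi
      (Alg.X_mul_K q) (fun v hv => ?_) (fun v hv => ?_) (fun v hv => ?_))
    · have h := congrArg (· • v) (Alg.E_mul_X q)
      simp only [smul_assoc, mul_smul, hv, smul_zero] at h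
      exact (smul_eq_zero_iff_right hq0).1 h.symm
    · rw [hv, smul_zero]
    · rw [← mul_smul, Alg.X_mul_Y, smul_assoc, mul_smul, hv, smul_zero, smul_zero]
  have hE : Alg.of q .E ∈ Module.annihilator (Alg q) M := by
    refine mem_annihilator_of_mul_K q (inv_ne_zero (pow_ne_zero 2 hq0)) hq2
      (Alg.E_mul_K q) (fun v hv => ?_) (fun v hv => ?_) (fun v hv => ?_)
    · rw [hv, smul_zero]
    · rw [hX, smul_zero]
    · rw [← mul_smul, Alg.E_mul_Y, add_smul, smul_assoc, mul_smul, hv, hX, smul_zero, smul_zero,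
        add_zero]
  refine ⟨hE, mem_annihilator_of_mul_K q hq0 hq (Alg.Y_mul_K q)
    (fun v _ => ?_) (fun v _ => ?_) (fun v hv => ?_)⟩
  · rw [Module.mem_annihilator.1 hE, smul_zero]
  · rw [hX, smul_zero]
  · rw [hv, smul_zero]

end FiniteDimensional

/-! ### Maximal left ideals above a two-sided ideal containing `E` and `Y`. -/

section Classification

variable {𝕜 : Type*} [Field 𝕜] (q : 𝕜)

/-- Although `J` is only a left ideal, each element is congruent modulo `I ≤ J` to a Laurent
polynomial in `K`, so `J` is determined by its contraction to `𝕜[K, K⁻¹]`. -/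
theorem exists_eq_idealYE_of_isMaximal {I J : Ideal (Alg q)} [I.IsTwoSided] (hE : Alg.of q .E ∈ I)
    (hY : Alg.of q .Y ∈ I) (hIJ : I ≤ J) (hJ : J.IsMaximal) :
    ∃ p : Ideal (LaurentPolynomial 𝕜), p.IsMaximal ∧ J = idealYE q p := by
  have h : J = idealYE q (J.comap (Alg.ofLaurent q)) := by
    rw [idealYE_eq_comap]
    ext a
    have ha := hIJ (sub_ofLaurent_toLaurent_mem q hE hY a)
    rw [Ideal.mem_comap, Ideal.mem_comap]
    exact ⟨fun h => by simpa using J.sub_mem h ha, fun h => by simpa using J.add_mem ha h⟩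
  exact ⟨_, isMaximal_of_idealYE_isMaximal q _ (h ▸ hJ), h⟩

end Classification

end QuantumAgeing

theorem theorem3 {𝕜 : Type*} [Field 𝕜] (q : 𝕜) (hq0 : q ≠ 0)
    (hq : ∀ n : ℕ, 0 < n → q ^ n ≠ 1) :
    -- every `𝓐 ⧸ (Y, E, 𝔭)` is a simple finite-dimensional module with annihilator `(Y, E, 𝔭)`,
    -- and it is `𝕜[K, K⁻¹] ⧸ 𝔭` with `K` acting as the variable and `E`, `X`, `Y` acting as `0`
    (∀ p : Ideal (LaurentPolynomial 𝕜), p.IsMaximal →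
      IsSimpleModule (QuantumAgeing.Alg q) (QuantumAgeing.Alg q ⧸ QuantumAgeing.idealYE q p) ∧
      FiniteDimensional 𝕜 (QuantumAgeing.Alg q ⧸ QuantumAgeing.idealYE q p) ∧
      Module.annihilator (QuantumAgeing.Alg q)
        (QuantumAgeing.Alg q ⧸ QuantumAgeing.idealYE q p) = QuantumAgeing.idealYE q p ∧
      ∃ e : (QuantumAgeing.Alg q ⧸ QuantumAgeing.idealYE q p) ≃ₐ[𝕜] (LaurentPolynomial 𝕜 ⧸ p),
        e (Ideal.Quotient.mk _ (QuantumAgeing.Alg.of q .K)) =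
          Ideal.Quotient.mk p (LaurentPolynomial.T 1) ∧
        e (Ideal.Quotient.mk _ (QuantumAgeing.Alg.of q .E)) = 0 ∧
        e (Ideal.Quotient.mk _ (QuantumAgeing.Alg.of q .X)) = 0 ∧
        e (Ideal.Quotient.mk _ (QuantumAgeing.Alg.of q .Y)) = 0) ∧
    -- different maximal ideals give non-isomorphic modules
    (∀ p p' : Ideal (LaurentPolynomial 𝕜), p.IsMaximal → p'.IsMaximal →
      Nonempty ((QuantumAgeing.Alg q ⧸ QuantumAgeing.idealYE q p) ≃ₗ[QuantumAgeing.Alg q]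
        (QuantumAgeing.Alg q ⧸ QuantumAgeing.idealYE q p')) → p = p') ∧
    -- the simple finite-dimensional modules are, up to isomorphism, exactly these; they are also
    -- exactly the simple modules whose annihilator belongs to the family `𝓟`
    (∀ (M : Type*) [AddCommGroup M] [Module 𝕜 M] [Module (QuantumAgeing.Alg q) M]
      [IsScalarTower 𝕜 (QuantumAgeing.Alg q) M], IsSimpleModule (QuantumAgeing.Alg q) M →
      (FiniteDimensional 𝕜 M ↔ ∃ p : Ideal (LaurentPolynomial 𝕜), p.IsMaximal ∧
        Nonempty (M ≃ₗ[QuantumAgeing.Alg q]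
          (QuantumAgeing.Alg q ⧸ QuantumAgeing.idealYE q p))) ∧
      (FiniteDimensional 𝕜 M ↔
        Module.annihilator (QuantumAgeing.Alg q) M ∈ QuantumAgeing.familyP q)) := by
  refine ⟨fun p hp => ?_, fun p p' hp hp' ⟨e⟩ => ?_, fun M _ _ _ _ hM => ?_⟩
  · refine ⟨isSimpleModule_iff_isCoatom.2 (idealYE_isMaximal q p).out,
      finiteDimensional_quotient_idealYE q p, Ideal.annihilator_quotient,
      quotientIdealYEEquiv q p, ?_⟩
    simp [quotientIdealYEEquiv_mk, Alg.toLaurent_of, toLaurentGen]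
  · apply idealYE_injective q
    rw [← Ideal.annihilator_quotient (I := idealYE q p), e.annihilator_eq,
      Ideal.annihilator_quotient]
  · have hfin : ∀ p : Ideal (LaurentPolynomial 𝕜), p.IsMaximal →
        Nonempty (M ≃ₗ[Alg q] (Alg q ⧸ idealYE q p)) → FiniteDimensional 𝕜 M := by
      rintro p hp ⟨e⟩
      have := finiteDimensional_quotient_idealYE q p
      exact Module.Finite.equiv (e.restrictScalars 𝕜).symm
    obtain ⟨J, hJ, ⟨e⟩⟩ := isSimpleModule_iff_quot_maximal.1 hM
    have hle : Module.annihilator (Alg q) M ≤ J := fun a ha => by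
      -- An annihilating element kills the class of `1` in `𝓐 ⧸ J`, hence lies in `J`.
      have h := Module.mem_annihilator.1 (e.annihilator_eq ▸ ha) (Submodule.Quotient.mk 1)
      rwa [← Submodule.Quotient.mk_smul, Submodule.Quotient.mk_eq_zero, smul_eq_mul, mul_one] at h
    have hex : FiniteDimensional 𝕜 M → ∃ p : Ideal (LaurentPolynomial 𝕜), p.IsMaximal ∧
        Nonempty (M ≃ₗ[Alg q] (Alg q ⧸ idealYE q p)) := fun hfd => by
      obtain ⟨hE, hY⟩ := E_Y_mem_annihilator q M hq0 hq
      obtain ⟨p, hp, rfl⟩ := exists_eq_idealYE_of_isMaximal q hE hY hle hJ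
      exact ⟨p, hp, ⟨e⟩⟩
    refine ⟨⟨hex, fun ⟨p, hp, h⟩ => hfin p hp h⟩, fun hfd => ?_, fun ⟨p, hp, h⟩ => ?_⟩
    · obtain ⟨p, hp, ⟨e'⟩⟩ := hex hfd
      exact ⟨p, hp, by rw [e'.annihilator_eq, Ideal.annihilator_quotient]⟩
    · rw [h] at hle
      -- The annihilator is already maximal as a left ideal, so it equals `J`.
      obtain rfl := (idealYE_isMaximal q p).eq_of_le hJ.ne_top hle
      exact hfin p hp ⟨e⟩
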